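/- Let $R$ be a principal ideal domain, and let $X^{(0)}$ be a lower bidiagonal $N\times N$ matrix over $R$ with diagonal entries $q_0^{(0)},\dots,q_{N-1}^{(0)}$ and subdiagonal entries $e_0^{(0)},\dots,e_{N-2}^{(0)}$ (where $e_n^{(0)}$ stands in row $n+1$ and column $n$, rows and columns being numbered from $0$), all of them nonzero. Consider the gcd-Toda lattice $$q_n^{(t+1)}=\gcd\Bigl(e_n^{(t)},\ \prod_{j=0}^{n}q_j^{(t)}\Big/\prod_{j=0}^{n-1}q_j^{(t+1)}\Bigr)\quad(0\le n\le N-1),$$ $$e_n^{(t+1)}=e_n^{(t)}q_{n+1}^{(t)}\big/q_n^{(t+1)}\quad(0\le n\le N-2),\qquad e_{N-1}^{(t)}=0,$$ for $t=0,1,2,\dots$, where at every step any greatest common divisor (it is unique up to a unit) may be chosen and $b/a$ denotes the element $c\in R$ with $b=ac$. Let $X^{(t)}$ be the lower bidiagonal matrix with diagonal entries $q_n^{(t)}$ and subdiagonal entries $e_n^{(t)}$. A Smith normal form of an $N\times N$ matrix $A$ over $R$ is a diagonal matrix $PAQ=\mathrm{diag}(s_0,\dots,s_{N-1})$ with $P,Q$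 invertible over $R$ and $s_i\mid s_{i+1}$ for $0\le i\le N-2$; its nonzero entries are the invariant factors of $A$. Then: 1. The system has a solution with initial value $X^{(0)}$, and in every such solution all $q_n^{(t)}$ $(0\le n\le N-1)$ and $e_n^{(t)}$ $(0\le n\le N-2)$ are nonzero. For every such solution: 2. The invariant factors of $X^{(t)}$ do not depend on $t$: for every $t$, the matrices $X^{(t)}$ and $X^{(0)}$ have the same Smith normal forms. 3. There is a $T$ such that for all $t\ge T$ the matrix $\mathrm{diag}(q_0^{(t)},\dots,q_{N-1}^{(t)})$ is a Smith normal form of $X^{(0)}$, and for every Smith normal form $\mathrm{diag}(s_0,\dots,s_{N-1})$ of $X^{(0)}$ the elements $q_n^{(t)}$ and $s_n$ differ by a unit factor for each $n$. -/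

import Mathlib

namespace GcdToda

/-- `d` is a greatest common divisor of `a` and `b` (it is determined up to a unit). -/
def IsGcdOf {R : Type*} [CommRing R] (d a b : R) : Prop :=
  d ∣ a ∧ d ∣ b ∧ ∀ c : R, c ∣ a → c ∣ b → c ∣ d

/-- `c` is the exact quotient `b / a`, that is, `b = a * c`. -/
def IsQuotient {R : Type*} [CommRing R] (c b a : R) : Prop :=
  b = a * c

/-- The sequences `q t n` (for `n < N`) and `e t n` (for `n + 1 < N`) solve the gcd-Toda lattice
of size `N`, with the boundary condition `e t (N - 1) = 0`. Here `q t n` is the variable `q_n` at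
time `t`; values with `n ≥ N` play no role. At every step any of the associated greatest common
divisors may be taken. -/
structure IsSolution {R : Type*} [CommRing R] (N : ℕ) (q e : ℕ → ℕ → R) : Prop where
  /-- `q_n^(t+1) = gcd (e_n^(t), (∏_{j ≤ n} q_j^(t)) / (∏_{j < n} q_j^(t+1)))` -/
  q_step : ∀ t n : ℕ, n < N → ∃ c : R,
    IsQuotient c (∏ j ∈ Finset.range (n + 1), q t j) (∏ j ∈ Finset.range n, q (t + 1) j) ∧
      IsGcdOf (q (t + 1) n) (e t n) c
  /-- `e_n^(t+1) = e_n^(t) q_{n+1}^(t) / q_n^(t+1)` -/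
  e_step : ∀ t n : ℕ, n + 1 < N → IsQuotient (e (t + 1) n) (e t n * q t (n + 1)) (q (t + 1) n)
  /-- `e_{N-1}^(t) = 0` -/
  e_boundary : ∀ t n : ℕ, n + 1 = N → e t n = 0

/-- The `N × N` lower bidiagonal matrix with diagonal entries `q 0, …, q (N - 1)` and subdiagonal
entries `e 0, …, e (N - 2)`, where `e j` stands in row `j + 1` and column `j`. -/
def bidiagonal {R : Type*} [CommRing R] (N : ℕ) (q e : ℕ → R) : Matrix (Fin N) (Fin N) R :=
  Matrix.of fun i j =>
    if (i : ℕ) = (j : ℕ) then q j else if (i : ℕ) = (j : ℕ) + 1 then e j else 0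

/-- The entries off the diagonal and the subdiagonal vanish. -/
def IsLowerBidiagonal {R : Type*} [CommRing R] {N : ℕ} (A : Matrix (Fin N) (Fin N) R) : Prop :=
  ∀ i j : Fin N, (i : ℕ) ≠ (j : ℕ) → (i : ℕ) ≠ (j : ℕ) + 1 → A i j = 0

/-- `diagonal s` is a Smith normal form of the square matrix `A`: it is `P * A * Q` with invertible
`P` and `Q`, and each entry divides the later ones. The nonzero entries of `s` are the invariant
factors of `A`; zeros, if any, come last by the divisibility. -/
def IsInvariantFactors {R : Type*} [CommRing R] {N : ℕ} (A : Matrix (Fin N) (Fin N) R)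
    (s : Fin N → R) : Prop :=
  (∃ P Q : GL (Fin N) R,
      (P : Matrix (Fin N) (Fin N) R) * A * (Q : Matrix (Fin N) (Fin N) R) = Matrix.diagonal s) ∧
    ∀ i j : Fin N, i ≤ j → s i ∣ s j

end GcdToda

/-! One step of the lattice can be written without division: the quotient inside the gcd is `α n * q
n`, where `α (n + 1)` and `b n` are the coprime cofactors left after the gcd `q' n` is removed from
`α n * q n` and `e n`. Then `e' n = b n * q (n + 1)`.

Invariance: the new matrix is compared with the old one through its transpose. At a maximal ideal
`m`, one of `b n` and `α (n + 1)` is a unit locally. In the first case column `n` of the new matrix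
is, up to scaling by local units, row `n + 1` of the old one; in the second it is a combination of
vectors `(α n * q n) • stdVec R N n`, which lie in both spans. So all determinantal ideals agree
(`TodaStep.detIdeal_eq`). Over a principal ideal domain these ideals determine the Smith form of a
nonsingular matrix, so the matrices are equivalent (`equivalent_of_detIdeal_eq`).

Convergence: once `α n` stays a unit, `q t n` descends in divisibility, so it stabilizes up to units
and `α (n + 1)` becomes a unit too (`exists_forall_isUnit`). After stabilization `q t n` divides `e
t n`, so the subdiagonal can be cleared. Iterating the recursion for `e` shows that every power of
`q t n` divides a fixed nonzero multiple of the same power of `q t (n + 1)`, which forces `q t n ∣ q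
t (n + 1)`. -/

namespace GcdToda

open Matrix

/-! ### Equivalence of matrices and elementary operations. -/

section Equivalence

variable {R : Type*} [CommRing R] {N : ℕ}

/-- Two square matrices are equivalent if they differ by invertible factors on both sides. -/
def Equivalent (A B : Matrix (Fin N) (Fin N) R) : Prop :=
  ∃ P Q : GL (Fin N) R,
    (P : Matrix (Fin N) (Fin N) R) * A * (Q : Matrix (Fin N) (Fin N) R) = B

theorem Equivalent.of_mul {A B P P' Q Q' : Matrix (Fin N) (Fin N) R} (hP : P * P' = 1)
    (hQ : Q * Q' = 1) (h : P * A * Q = B) : Equivalent A B :=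
  ⟨⟨P, P', hP, mul_eq_one_comm.mp hP⟩, ⟨Q, Q', hQ, mul_eq_one_comm.mp hQ⟩, h⟩

theorem Equivalent.refl (A : Matrix (Fin N) (Fin N) R) : Equivalent A A :=
  .of_mul (mul_one 1) (mul_one 1) (by simp)

theorem Equivalent.symm {A B : Matrix (Fin N) (Fin N) R} (h : Equivalent A B) :
    Equivalent B A := by
  obtain ⟨P, Q, rfl⟩ := h
  refine ⟨P⁻¹, Q⁻¹, ?_⟩
  calc (↑P⁻¹ : Matrix (Fin N) (Fin N) R) * (↑P * A * ↑Q) * (↑Q⁻¹ : Matrix (Fin N) (Fin N) R)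
      = (↑P⁻¹ * ↑P) * A * (↑Q * ↑Q⁻¹) := by simp only [Matrix.mul_assoc]
    _ = A := by rw [Units.inv_mul, Units.mul_inv, one_mul, mul_one]

theorem Equivalent.trans {A B C : Matrix (Fin N) (Fin N) R} (h : Equivalent A B)
    (h' : Equivalent B C) : Equivalent A C := by
  obtain ⟨P, Q, rfl⟩ := h
  obtain ⟨P', Q', rfl⟩ := h'
  exact ⟨P' * P, Q * Q', by simp only [Units.val_mul, Matrix.mul_assoc]⟩

theorem Equivalent.transpose {A B : Matrix (Fin N) (Fin N) R} (h : Equivalent A B) :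
    Equivalent Aᵀ Bᵀ := by
  obtain ⟨P, Q, rfl⟩ := h
  refine .of_mul (P := (Q : Matrix (Fin N) (Fin N) R)ᵀ)
    (P' := (↑Q⁻¹ : Matrix (Fin N) (Fin N) R)ᵀ)
    (Q := (P : Matrix (Fin N) (Fin N) R)ᵀ) (Q' := (↑P⁻¹ : Matrix (Fin N) (Fin N) R)ᵀ) ?_ ?_ ?_
  · rw [← transpose_mul, Units.inv_mul, transpose_one]
  · rw [← transpose_mul, Units.inv_mul, transpose_one]
  · simp only [transpose_mul, Matrix.mul_assoc]

theorem Equivalent.smul {A B : Matrix (Fin N) (Fin N) R} (h : Equivalent A B) (x : R) :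
    Equivalent (x • A) (x • B) := by
  obtain ⟨P, Q, rfl⟩ := h
  exact ⟨P, Q, by simp⟩

theorem Equivalent.isInvariantFactors_iff {A B : Matrix (Fin N) (Fin N) R} (h : Equivalent A B)
    (s : Fin N → R) : IsInvariantFactors A s ↔ IsInvariantFactors B s :=
  and_congr_left fun _ => ⟨fun hA => h.symm.trans hA, fun hB => h.trans hB⟩

theorem Equivalent.diagonal_of_associated {s s' : Fin N → R}
    (h : ∀ i, Associated (s i) (s' i)) : Equivalent (diagonal s) (diagonal s') := by
  choose u hu using h
  refine .of_mul (P := 1) (P' := 1) (Q := diagonal fun i => (u i : R))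
    (Q' := diagonal fun i => (↑(u i)⁻¹ : R)) (mul_one 1) ?_ ?_
  · simp
  · simp [hu]

/-- The matrix of the unimodular row operation with coefficients `u, v, -b, a` on the rows
`i` and `j`. -/
def rowPairMatrix (i j : Fin N) (u v a b : R) : Matrix (Fin N) (Fin N) R :=
  ((1 : Matrix (Fin N) (Fin N) R).updateRow i (u • Pi.single i 1 + v • Pi.single j 1)).updateRow j
    (-b • Pi.single i 1 + a • Pi.single j 1)

theorem rowPairMatrix_mul {i j : Fin N} (hij : i ≠ j) (u v a b : R)
    (M : Matrix (Fin N) (Fin N) R) :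
    rowPairMatrix i j u v a b * M =
      (M.updateRow i (u • M i + v • M j)).updateRow j (-b • M i + a • M j) := by
  have key : ∀ l, (rowPairMatrix i j u v a b * M) l = (rowPairMatrix i j u v a b) l ᵥ* M :=
    fun l => rfl
  funext l
  rw [key]
  by_cases hj : l = j
  · subst hj
    simp [rowPairMatrix, add_vecMul, smul_vecMul, neg_vecMul, Matrix.row]
  · by_cases hi : l = i
    · subst hi
      simp [rowPairMatrix, updateRow_ne hij, add_vecMul, smul_vecMul, Matrix.row]
    · simp only [rowPairMatrix, updateRow_ne hj, updateRow_ne hi]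
      rw [show (1 : Matrix (Fin N) (Fin N) R) l = Pi.single l 1 by
        ext k
        simp [one_apply, Pi.single_apply, eq_comm]]
      simp [Matrix.row]

theorem rowPairMatrix_mul_inv {i j : Fin N} (hij : i ≠ j) {u v a b : R} (h : u * a + v * b = 1) :
    rowPairMatrix i j u v a b * rowPairMatrix i j a (-v) u (-b) = 1 := by
  rw [rowPairMatrix_mul hij]
  ext l k
  by_cases hj : l = j
  · subst hj
    simp only [rowPairMatrix, updateRow_self, updateRow_ne hij, Pi.add_apply, Pi.smul_apply,
      smul_eq_mul, one_apply, Pi.single_apply]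
    grind
  · by_cases hi : l = i
    · subst hi
      simp only [rowPairMatrix, updateRow_self, updateRow_ne hij, Pi.add_apply, Pi.smul_apply,
        smul_eq_mul, one_apply, Pi.single_apply]
      grind
    · simp [rowPairMatrix, updateRow_ne hj, updateRow_ne hi]

theorem Equivalent.rowPair (A : Matrix (Fin N) (Fin N) R) {i j : Fin N} (hij : i ≠ j)
    {u v a b : R} (h : u * a + v * b = 1) :
    Equivalent A ((A.updateRow i (u • A i + v • A j)).updateRow j (-b • A i + a • A j)) :=
  .of_mul (rowPairMatrix_mul_inv hij h) (mul_one 1) (by rw [rowPairMatrix_mul hij, mul_one])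

/-- The block matrix with blocks `1` and `A`. -/
def oneBlock (A : Matrix (Fin N) (Fin N) R) : Matrix (Fin (N + 1)) (Fin (N + 1)) R :=
  of (Fin.cons (Fin.cons 1 0) fun i => Fin.cons 0 (A i))

/-- The identity matrix with the first column replaced by `1, c`. -/
def firstColumn (c : Fin N → R) : Matrix (Fin (N + 1)) (Fin (N + 1)) R :=
  of (Fin.cons (Fin.cons 1 0) fun i => Fin.cons (c i) ((1 : Matrix (Fin N) (Fin N) R) i))

theorem oneBlock_mul (A B : Matrix (Fin N) (Fin N) R) :
    oneBlock A * oneBlock B = oneBlock (A * B) := by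
  ext i j
  refine Fin.cases ?_ (fun i => ?_) i <;> refine Fin.cases ?_ (fun j => ?_) j <;>
    simp [oneBlock, mul_apply, Fin.sum_univ_succ]

theorem oneBlock_diagonal (s : Fin N → R) :
    oneBlock (diagonal s) = diagonal (Fin.cons 1 s) := by
  ext i j
  refine Fin.cases ?_ (fun i => ?_) i <;> refine Fin.cases ?_ (fun j => ?_) j <;>
    simp [oneBlock, diagonal_apply, Fin.succ_ne_zero, (Fin.succ_ne_zero _).symm]

theorem oneBlock_one : oneBlock (1 : Matrix (Fin N) (Fin N) R) = 1 := by
  rw [← diagonal_one, oneBlock_diagonal, ← diagonal_one]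
  congr 1
  ext i
  refine Fin.cases ?_ (fun i => ?_) i <;> simp

theorem firstColumn_mul_neg (c : Fin N → R) : firstColumn c * firstColumn (-c) = 1 := by
  ext i j
  refine Fin.cases ?_ (fun i => ?_) i <;> refine Fin.cases ?_ (fun j => ?_) j <;>
    simp [firstColumn, mul_apply, Fin.sum_univ_succ, one_apply, Fin.succ_ne_zero,
      (Fin.succ_ne_zero _).symm]

theorem Equivalent.oneBlock {A B : Matrix (Fin N) (Fin N) R} (h : Equivalent A B) :
    Equivalent (oneBlock A) (oneBlock B) := by
  obtain ⟨P, Q, rfl⟩ := h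
  refine .of_mul (P := GcdToda.oneBlock P) (P' := GcdToda.oneBlock ↑P⁻¹)
    (Q := GcdToda.oneBlock Q) (Q' := GcdToda.oneBlock ↑Q⁻¹) ?_ ?_ ?_
  · rw [oneBlock_mul, Units.mul_inv, oneBlock_one]
  · rw [oneBlock_mul, Units.mul_inv, oneBlock_one]
  · simp only [oneBlock_mul]

/-- Elimination with a pivot equal to `1`. -/
theorem exists_equivalent_oneBlock (C : Matrix (Fin (N + 1)) (Fin (N + 1)) R) (h : C 0 0 = 1) :
    ∃ C' : Matrix (Fin N) (Fin N) R, Equivalent C (oneBlock C') := by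
  let c : Fin N → R := fun i => C i.succ 0
  let r : Fin N → R := fun j => C 0 j.succ
  refine ⟨of fun i j => C i.succ j.succ - c i * r j, Equivalent.symm ?_⟩
  refine .of_mul (P := firstColumn c) (P' := firstColumn (-c)) (Q := (firstColumn r)ᵀ)
    (Q' := (firstColumn (-r))ᵀ) (firstColumn_mul_neg c) ?_ ?_
  · rw [← transpose_mul, ← transpose_one]
    congr 1
    exact mul_eq_one_comm.mp (firstColumn_mul_neg r)
  · ext i j
    refine Fin.cases ?_ (fun i => ?_) i <;> refine Fin.cases ?_ (fun j => ?_) j <;>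
      simp [firstColumn, GcdToda.oneBlock, mul_apply, Fin.sum_univ_succ, one_apply, h, c, r]

end Equivalence

/-! ### Existence of the Smith normal form. -/

section Existence

variable {R : Type*} [CommRing R] [IsDomain R] [IsPrincipalIdealRing R] {N : ℕ}

/-- The coprimality of the cofactors `a, b` is asked for separately, so that `u, v, -b, a` is
unimodular even when `x = y = 0`. -/
theorem exists_bezout (x y : R) :
    ∃ g u v a b : R, x = g * a ∧ y = g * b ∧ u * x + v * y = g ∧ u * a + v * b = 1 := by
  by_cases h : x = 0 ∧ y = 0
  · exact ⟨0, 1, 0, 1, 0, by simp [h.1], by simp [h.2], by simp [h.1], by simp⟩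
  obtain ⟨a, ha⟩ := IsBezout.gcd_dvd_left x y
  obtain ⟨b, hb⟩ := IsBezout.gcd_dvd_right x y
  obtain ⟨u, v, huv⟩ := IsBezout.gcd_eq_sum x y
  refine ⟨_, u, v, a, b, ha, hb, huv, ?_⟩
  have hg : IsBezout.gcd x y ≠ 0 := fun h0 => h ⟨by rw [ha, h0, zero_mul], by rw [hb, h0, zero_mul]⟩
  refine mul_left_cancel₀ hg ?_
  linear_combination huv - u * ha - v * hb

/-- A Bézout row operation replaces the pivot by its gcd with `A i 0`; maximality of the pivot's
ideal makes that gcd associated to the pivot. -/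
theorem dvd_of_maximal_pivot {A : Matrix (Fin (N + 1)) (Fin (N + 1)) R}
    (h : ∀ B, Equivalent A B → B 0 0 ∣ A 0 0 → A 0 0 ∣ B 0 0) (i : Fin (N + 1)) :
    A 0 0 ∣ A i 0 := by
  by_cases hi : i = 0
  · rw [hi]
  obtain ⟨g, u, v, a, b, hx, hy, hg, hab⟩ := exists_bezout (A 0 0) (A i 0)
  have hB := Equivalent.rowPair A (Ne.symm hi) hab
  have h00 : ((A.updateRow 0 (u • A 0 + v • A i)).updateRow i (-b • A 0 + a • A i)) 0 0 = g := by
    rw [updateRow_ne (Ne.symm hi), updateRow_self]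
    simpa using hg
  have := h _ hB (by rw [h00]; exact ⟨a, hx⟩)
  rw [h00] at this
  exact this.trans ⟨b, hy⟩

theorem dvd_all_of_maximal_pivot {A : Matrix (Fin (N + 1)) (Fin (N + 1)) R}
    (h : ∀ B, Equivalent A B → B 0 0 ∣ A 0 0 → A 0 0 ∣ B 0 0) (i j : Fin (N + 1)) :
    A 0 0 ∣ A i j := by
  have hrow : ∀ B, Equivalent A B → B 0 0 = A 0 0 → ∀ j, A 0 0 ∣ B 0 j := by
    intro B hAB hB j
    have := dvd_of_maximal_pivot (A := Bᵀ) (fun C hC hd => by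
      have := h Cᵀ (hAB.trans (by simpa using hC.transpose)) (by simpa [hB] using hd)
      simpa [hB] using this) j
    simpa [hB] using this
  by_cases hi : i = 0
  · rw [hi]
    exact hrow A (.refl A) rfl j
  obtain ⟨c, hc⟩ := dvd_of_maximal_pivot h i
  -- These coefficients keep the pivot, since `(1 - c) * A 0 0 + c * A 0 0 = A 0 0`, and bring row
  -- `i` into the first row, where divisibility is known.
  have hB := Equivalent.rowPair A (Ne.symm hi) (show (1 - c) * 1 + 1 * c = 1 by ring)
  have key := hrow _ hB (by
    rw [updateRow_ne (Ne.symm hi), updateRow_self]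
    simp [hc]
    ring) j
  rw [updateRow_ne (Ne.symm hi), updateRow_self] at key
  have h0 := hrow A (.refl A) rfl j
  have : A i j = ((1 - c) • A 0 + (1 : R) • A i) j - (1 - c) * A 0 j := by simp
  rw [this]
  exact dvd_sub key (h0.mul_left _)

theorem exists_pivot_dvd_all (A : Matrix (Fin (N + 1)) (Fin (N + 1)) R) :
    ∃ B, Equivalent A B ∧ ∀ i j, B 0 0 ∣ B i j := by
  obtain ⟨I, ⟨B, hB, rfl⟩, hmax⟩ := set_has_maximal_iff_noetherian.mpr
    (inferInstance : IsNoetherian R R) {I | ∃ B, Equivalent A B ∧ I = Ideal.span {B 0 0}}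
    ⟨_, A, .refl A, rfl⟩
  refine ⟨B, hB, dvd_all_of_maximal_pivot fun C hC hd => ?_⟩
  by_contra hnd
  refine hmax _ ⟨C, hB.trans hC, rfl⟩ (lt_of_le_of_ne ?_ fun heq => hnd ?_)
  · exact Ideal.span_singleton_le_span_singleton.mpr hd
  · exact Ideal.span_singleton_le_span_singleton.mp heq.ge

/-- Existence of the Smith normal form over a principal ideal domain. -/
theorem exists_isInvariantFactors :
    ∀ {N : ℕ} (A : Matrix (Fin N) (Fin N) R), ∃ s : Fin N → R, IsInvariantFactors A s
  | 0, A => ⟨fun _ => 1, Equivalent.refl A |>.trans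
      (by rw [Subsingleton.elim A]; exact .refl _), fun i => i.elim0⟩
  | N + 1, A => by
    obtain ⟨B, hAB, hB⟩ := exists_pivot_dvd_all A
    choose C hC using hB
    -- The corner is set to `1` by hand: when `B 0 0 = 0` the quotient `C 0 0` is arbitrary.
    let C₁ : Matrix (Fin (N + 1)) (Fin (N + 1)) R :=
      of fun i j => if i = 0 ∧ j = 0 then 1 else C i j
    have hBC : B = B 0 0 • C₁ := by
      ext i j
      by_cases hij : i = 0 ∧ j = 0
      · simp [C₁, hij]
      · simp [C₁, hij, ← hC]
    obtain ⟨C', hC'⟩ := exists_equivalent_oneBlock C₁ (by simp [C₁])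
    obtain ⟨s, hs, hdvd⟩ := exists_isInvariantFactors C'
    refine ⟨B 0 0 • (Fin.cons 1 s : Fin (N + 1) → R), ?_, ?_⟩
    · have h1 : Equivalent (B 0 0 • C₁) (B 0 0 • diagonal (Fin.cons 1 s : Fin (N + 1) → R)) := by
        rw [← oneBlock_diagonal]
        exact (hC'.trans (Equivalent.oneBlock hs)).smul _
      rw [← hBC, ← diagonal_smul] at h1
      exact hAB.trans h1
    · intro i j
      refine Fin.cases ?_ (fun i => ?_) i <;> refine Fin.cases ?_ (fun j => ?_) j
      · simp
      · simp
      · simp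
      · intro hij
        simpa using mul_dvd_mul_left _ (hdvd i j (Fin.succ_le_succ_iff.mp hij))

end Existence

end GcdToda

namespace GcdToda

open Matrix

/-! ### Determinantal ideals and uniqueness of invariant factors. -/

section Determinantal

variable {R : Type*} [CommRing R] {N : ℕ}

/-- The ideal generated by the minors of size `k`. The index maps need not be injective: a
repeated row or column contributes `0`. -/
def detIdeal (k : ℕ) (A : Matrix (Fin N) (Fin N) R) : Ideal R :=
  Ideal.span {x | ∃ f g : Fin k → Fin N, (A.submatrix f g).det = x}

theorem det_submatrix_mem_detIdeal {k : ℕ} (A : Matrix (Fin N) (Fin N) R) (f g : Fin k → Fin N) :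
    (A.submatrix f g).det ∈ detIdeal k A :=
  Ideal.subset_span ⟨f, g, rfl⟩

theorem detIdeal_le_iff {k : ℕ} {A : Matrix (Fin N) (Fin N) R} {I : Ideal R} :
    detIdeal k A ≤ I ↔ ∀ f g : Fin k → Fin N, (A.submatrix f g).det ∈ I := by
  rw [detIdeal, Ideal.span_le]
  exact ⟨fun h f g => h ⟨f, g, rfl⟩, by rintro h _ ⟨f, g, rfl⟩; exact h f g⟩

theorem detIdeal_mul_le (k : ℕ) (U A : Matrix (Fin N) (Fin N) R) :
    detIdeal k (U * A) ≤ detIdeal k A := by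
  refine detIdeal_le_iff.mpr fun f g => ?_
  have h : (U * A).submatrix f g =
      fun i => ∑ j, U (f i) j • (A.submatrix id g) j := by
    ext i l
    simp [mul_apply, Finset.sum_apply]
  -- Multilinear expansion along the rows, a Cauchy–Binet formula summed over all maps `r`,
  -- injective or not.
  have h2 : ((U * A).submatrix f g).det =
      ∑ r : Fin k → Fin N, (∏ i, U (f i) (r i)) • (A.submatrix r g).det := by
    rw [h]
    refine (detRowAlternating.toMultilinearMap.map_sum _).trans ?_
    refine Finset.sum_congr rfl fun r _ => ?_
    exact detRowAlternating.toMultilinearMap.map_smul_univ _ _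
  rw [h2]
  exact Ideal.sum_mem _ fun r _ => Ideal.mul_mem_left _ _ (det_submatrix_mem_detIdeal A r g)

theorem detIdeal_transpose (k : ℕ) (A : Matrix (Fin N) (Fin N) R) :
    detIdeal k Aᵀ = detIdeal k A := by
  have h : ∀ B : Matrix (Fin N) (Fin N) R, detIdeal k Bᵀ ≤ detIdeal k B := fun B => by
    refine detIdeal_le_iff.mpr fun f g => ?_
    rw [← transpose_submatrix, det_transpose]
    exact det_submatrix_mem_detIdeal B g f
  exact le_antisymm (h A) (by simpa using h Aᵀ)

theorem Equivalent.detIdeal_eq {A B : Matrix (Fin N) (Fin N) R} (h : Equivalent A B) (k : ℕ) :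
    detIdeal k A = detIdeal k B := by
  have key : ∀ {A B : Matrix (Fin N) (Fin N) R}, Equivalent A B → detIdeal k B ≤ detIdeal k A := by
    rintro A _ ⟨P, Q, rfl⟩
    rw [← detIdeal_transpose, transpose_mul]
    refine (detIdeal_mul_le k _ _).trans ?_
    rw [detIdeal_transpose]
    exact detIdeal_mul_le k _ _
  exact le_antisymm (key h.symm) (key h)

/-- Comparison of determinantal ideals, one maximal ideal at a time. -/
theorem detIdeal_le_of_local (k : ℕ) {A B : Matrix (Fin N) (Fin N) R}
    (h : ∀ m : Ideal R, m.IsMaximal → ∃ E C : Fin N → R, (∀ i, E i ∉ m) ∧ (∀ i, C i ∉ m) ∧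
      ∀ i, (diagonal E * B * diagonal C) i ∈ Submodule.span R (Set.range A)) :
    detIdeal k B ≤ detIdeal k A := by
  refine detIdeal_le_iff.mpr fun f g => ?_
  set x := (B.submatrix f g).det
  by_contra hx
  -- The ideal of all `c` with `c * x ∈ detIdeal k A`. It is proper if `x` is not in `detIdeal k A`,
  -- while the scaling factors of the minor `x` multiply to an element of `J` outside `m`.
  let J : Ideal R := Submodule.comap (LinearMap.toSpanSingleton R R x) (detIdeal k A)
  have hJ : ∀ c, c ∈ J ↔ c * x ∈ detIdeal k A := fun c => by simp [J]
  obtain ⟨m, hm, hJm⟩ := Ideal.exists_le_maximal J (by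
    rw [Ne, Ideal.eq_top_iff_one, hJ, one_mul]
    exact hx)
  obtain ⟨E, C, hE, hC, hrow⟩ := h m hm
  have hmem : (∏ i, E (f i)) * (∏ i, C (g i)) ∈ J := by
    choose U hU using fun i => (Submodule.mem_span_range_iff_exists_fun R).mp (hrow i)
    have hUA : diagonal E * B * diagonal C = of U * A := by
      ext i j
      rw [← hU i]
      simp [mul_apply, Finset.sum_apply]
    have hsub : (diagonal E * B * diagonal C).submatrix f g =
        diagonal (E ∘ f) * B.submatrix f g * diagonal (C ∘ g) := by
      ext i j
      simp
    rw [hJ]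
    have := detIdeal_mul_le k (of U) A (by
      rw [← hUA]
      exact det_submatrix_mem_detIdeal _ f g)
    rw [hsub, det_mul, det_mul, det_diagonal, det_diagonal] at this
    convert this using 1
    simp only [Function.comp, x]
    ring
  have hp := hm.isPrime
  rcases hp.mem_or_mem (hJm hmem) with h | h
  · obtain ⟨i, -, hi⟩ := hp.prod_mem_iff.mp h
    exact hE _ hi
  · obtain ⟨i, -, hi⟩ := hp.prod_mem_iff.mp h
    exact hC _ hi

theorem val_le_of_strictMono {k : ℕ} {f : Fin k → Fin N} (hf : StrictMono f) (i : Fin k) :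
    (i : ℕ) ≤ f i := by
  obtain ⟨i, hi⟩ := i
  induction i with
  | zero => exact Nat.zero_le _
  | succ i ih =>
    have h : f ⟨i, by omega⟩ < f ⟨i + 1, hi⟩ := hf (Fin.mk_lt_mk.mpr (Nat.lt_succ_self i))
    have := ih (by omega)
    simp only [Fin.lt_def] at h this ⊢
    omega

/-- Sort the chosen indices: the `i`-th smallest of them is at least `i`. -/
theorem prod_castLE_dvd_prod {k : ℕ} (hk : k ≤ N) {s : Fin N → R}
    (hs : ∀ i j, i ≤ j → s i ∣ s j) {g : Fin k → Fin N} (hg : Function.Injective g) :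
    ∏ i, s (Fin.castLE hk i) ∣ ∏ i, s (g i) := by
  let t : Finset (Fin N) := Finset.univ.map ⟨g, hg⟩
  have ht : t.card = k := by simp [t]
  have h1 : ∏ i, s (g i) = ∏ x ∈ t, s x := by simp [t]
  have h2 : ∏ x ∈ t, s x = ∏ i, s (t.orderEmbOfFin ht i) := by
    rw [← Finset.prod_coe_sort t, ← (t.orderIsoOfFin ht).toEquiv.prod_comp]
    simp
  rw [h1, h2]
  exact Finset.prod_dvd_prod_of_dvd _ _ fun i _ =>
    hs _ _ (Fin.le_def.mpr (val_le_of_strictMono (t.orderEmbOfFin ht).strictMono i))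

theorem detIdeal_diagonal {k : ℕ} (hk : k ≤ N) {s : Fin N → R}
    (hs : ∀ i j, i ≤ j → s i ∣ s j) :
    detIdeal k (diagonal s) = Ideal.span {∏ i, s (Fin.castLE hk i)} := by
  refine le_antisymm (detIdeal_le_iff.mpr fun f g => ?_) ?_
  · rw [Ideal.mem_span_singleton]
    by_cases hg : Function.Injective g
    · rw [det_apply]
      refine Finset.dvd_sum fun σ _ => ?_
      rw [Units.smul_def, zsmul_eq_mul]
      refine Dvd.dvd.mul_left ((prod_castLE_dvd_prod hk hs hg).trans ?_) _
      refine Finset.prod_dvd_prod_of_dvd _ _ fun i _ => ?_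
      rw [submatrix_apply, diagonal_apply]
      split_ifs with h
      · rw [h]
      · exact dvd_zero _
    · obtain ⟨i, j, hij, hne⟩ : ∃ i j, g i = g j ∧ i ≠ j := by
        simpa [Function.Injective] using hg
      rw [det_zero_of_column_eq hne fun l => by simp [hij]]
      exact dvd_zero _
  · rw [Ideal.span_singleton_le_iff_mem]
    have h := det_submatrix_mem_detIdeal (diagonal s) (Fin.castLE hk) (Fin.castLE hk)
    rwa [submatrix_diagonal _ _ (Fin.castLE_injective hk), det_diagonal] at h

variable [IsDomain R]

/-- The invariant factors are determined, up to units, by the determinantal ideals. -/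
theorem IsInvariantFactors.associated {A B : Matrix (Fin N) (Fin N) R} {s s' : Fin N → R}
    (hA : IsInvariantFactors A s) (hB : IsInvariantFactors B s') (hdet : A.det ≠ 0)
    (h : ∀ k, detIdeal k A = detIdeal k B) (n : Fin N) : Associated (s n) (s' n) := by
  have hs : ∀ i, s i ≠ 0 := by
    obtain ⟨⟨P, Q, hPQ⟩, -⟩ := hA
    have h0 : ∏ i, s i ≠ 0 := by
      rw [← det_diagonal, ← hPQ, det_mul, det_mul]
      exact mul_ne_zero (mul_ne_zero ((isUnit_iff_isUnit_det _).mp P.isUnit).ne_zero hdet)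
        ((isUnit_iff_isUnit_det _).mp Q.isUnit).ne_zero
    exact fun i => Finset.prod_ne_zero_iff.mp h0 i (Finset.mem_univ i)
  have key : ∀ k (hk : k ≤ N),
      Associated (∏ i, s (Fin.castLE hk i)) (∏ i, s' (Fin.castLE hk i)) := fun k hk => by
    rw [← Ideal.span_singleton_eq_span_singleton, ← detIdeal_diagonal hk hA.2,
      ← detIdeal_diagonal hk hB.2, ← Equivalent.detIdeal_eq hA.1, ← Equivalent.detIdeal_eq hB.1, h]
  -- The factor `s n` is the quotient of the generators of two consecutive determinantal ideals.
  have h1 := key n n.2.le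
  have h2 := key (n + 1) n.2
  rw [Fin.prod_univ_castSucc, Fin.prod_univ_castSucc] at h2
  exact Associated.of_mul_left h2 h1 (Finset.prod_ne_zero_iff.mpr fun i _ => hs _)

theorem equivalent_of_detIdeal_eq [IsPrincipalIdealRing R] {A B : Matrix (Fin N) (Fin N) R}
    (hdet : A.det ≠ 0) (h : ∀ k, detIdeal k A = detIdeal k B) : Equivalent A B := by
  obtain ⟨s, hs⟩ := exists_isInvariantFactors A
  obtain ⟨s', hs'⟩ := exists_isInvariantFactors B
  exact Equivalent.trans hs.1 ((Equivalent.diagonal_of_associated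
    (hs.associated hs' hdet h)).trans (Equivalent.symm hs'.1))

end Determinantal

end GcdToda

namespace GcdToda

open Matrix

/-! ### Invariance of the determinantal ideals under one step. -/

section Step

variable {R : Type*} [CommRing R] {N : ℕ}

/-- One step `(q, e) ↦ (q', e')` of the gcd-Toda lattice in division-free form: `q' n` is the
common factor of `α n * q n = q' n * α (n + 1)` and `e n = q' n * b n`. -/
structure TodaStep (N : ℕ) (q e q' e' α b : ℕ → R) : Prop where
  α_zero : α 0 = 1
  q_eq : ∀ n, n < N → q' n * α (n + 1) = α n * q n
  e_eq : ∀ n, n < N → e n = q' n * b n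
  e'_eq : ∀ n, n + 1 < N → e' n = b n * q (n + 1)
  coprime : ∀ n, n < N → IsCoprime (α (n + 1)) (b n)
  b_last : ∀ n, n + 1 = N → b n = 0

/-- The `n`-th standard basis vector, and zero when `n ≥ N`. -/
def stdVec (R : Type*) [CommRing R] (N n : ℕ) : Fin N → R :=
  fun j => if (j : ℕ) = n then 1 else 0

theorem stdVec_eq_zero {n : ℕ} (h : N ≤ n) : stdVec R N n = 0 := by
  ext j
  simp only [stdVec, Pi.zero_apply, ite_eq_right_iff]
  omega

theorem scaled_transpose_row (E c q e : ℕ → R) (i : Fin N) :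
    (diagonal (fun i : Fin N => E i) * (bidiagonal N q e)ᵀ * diagonal fun i : Fin N => c i) i =
      (E i * q i * c i) • stdVec R N i + (E i * e i * c (i + 1)) • stdVec R N (i + 1) := by
  ext j
  simp only [mul_diagonal, diagonal_mul, transpose_apply, bidiagonal, of_apply, stdVec,
    Pi.add_apply, Pi.smul_apply, smul_eq_mul]
  split_ifs with h1 h2 h3
  · omega
  · simp [h1]
  · simp [h3]
  · simp

theorem scaled_row_zero (E c q e : ℕ → R) (i : Fin N) (hi : (i : ℕ) = 0) :
    (diagonal (fun i : Fin N => E i) * bidiagonal N q e * diagonal fun i : Fin N => c i) i =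
      (E 0 * q 0 * c 0) • stdVec R N 0 := by
  ext j
  simp only [mul_diagonal, diagonal_mul, bidiagonal, of_apply, stdVec, Pi.smul_apply, smul_eq_mul,
    hi]
  split_ifs with h1 h2 h3 <;> first | omega | skip
  · simp [← h1]
  · exact h3.elim
  · simp

theorem scaled_row_succ (E c q e : ℕ → R) (i : Fin N) (n : ℕ) (hi : (i : ℕ) = n + 1) :
    (diagonal (fun i : Fin N => E i) * bidiagonal N q e * diagonal fun i : Fin N => c i) i =
      (E (n + 1) * e n * c n) • stdVec R N n +
        (E (n + 1) * q (n + 1) * c (n + 1)) • stdVec R N (n + 1) := by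
  ext j
  simp only [mul_diagonal, diagonal_mul, bidiagonal, of_apply, stdVec, Pi.smul_apply, smul_eq_mul,
    hi, Pi.add_apply]
  split_ifs with h1 h2 h3 h4 h5 h6 <;> first | omega | skip
  · simp [← h1]
  · rw [show (j : ℕ) = n by omega]
    simp
  · simp

theorem bidiagonal_row_zero (q e : ℕ → R) (i : Fin N) (hi : (i : ℕ) = 0) :
    bidiagonal N q e i = q 0 • stdVec R N 0 := by
  simpa using scaled_row_zero (fun _ => 1) (fun _ => 1) q e i hi

theorem bidiagonal_row_succ (q e : ℕ → R) (i : Fin N) (n : ℕ) (hi : (i : ℕ) = n + 1) :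
    bidiagonal N q e i = e n • stdVec R N n + q (n + 1) • stdVec R N (n + 1) := by
  simpa using scaled_row_succ (fun _ => 1) (fun _ => 1) q e i n hi

theorem bidiagonal_transpose_row (q e : ℕ → R) (i : Fin N) :
    (bidiagonal N q e)ᵀ i = q i • stdVec R N i + e i • stdVec R N (i + 1) := by
  simpa using scaled_transpose_row (fun _ => 1) (fun _ => 1) q e i

variable {q e q' e' α b : ℕ → R}

/-- Upward elimination: `α (n + 1) * e n = b n * (α n * q n)`, so the previous vector cancels the
subdiagonal entry of `α (n + 1)` times row `n + 1`. -/
theorem TodaStep.smul_stdVec_mem_rows (h : TodaStep N q e q' e' α b) (n : ℕ) :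
    (α n * q n) • stdVec R N n ∈ Submodule.span R (Set.range (bidiagonal N q e)) := by
  induction n with
  | zero =>
    rcases Nat.eq_zero_or_pos N with h0 | hN
    · rw [stdVec_eq_zero (by omega), smul_zero]
      exact zero_mem _
    · rw [h.α_zero, one_mul, ← bidiagonal_row_zero q e ⟨0, hN⟩ rfl]
      exact Submodule.subset_span ⟨_, rfl⟩
  | succ n ih =>
    rcases Nat.lt_or_ge (n + 1) N with hn | hn
    · have hrow : bidiagonal N q e ⟨n + 1, hn⟩ ∈
          Submodule.span R (Set.range (bidiagonal N q e)) := Submodule.subset_span ⟨_, rfl⟩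
      rw [bidiagonal_row_succ q e ⟨n + 1, hn⟩ n rfl] at hrow
      convert sub_mem (Submodule.smul_mem _ (α (n + 1)) hrow) (Submodule.smul_mem _ (b n) ih)
        using 1
      have h1 := h.q_eq n (by omega)
      have h2 := h.e_eq n (by omega)
      have h3 : α (n + 1) * e n = b n * (α n * q n) := by rw [h2, ← h1]; ring
      rw [smul_add, smul_smul, smul_smul, smul_smul, h3, add_sub_cancel_left]
    · rw [stdVec_eq_zero hn, smul_zero]
      exact zero_mem _

/-- The same vectors, now by elimination from the last column back to column `n`. -/
theorem TodaStep.smul_stdVec_mem_columns (h : TodaStep N q e q' e' α b) (n : ℕ) :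
    (α n * q n) • stdVec R N n ∈ Submodule.span R (Set.range (bidiagonal N q' e')ᵀ) := by
  rcases Nat.lt_or_ge n N with hn | hn
  swap
  · rw [stdVec_eq_zero hn, smul_zero]
    exact zero_mem _
  obtain ⟨k, hk⟩ : ∃ k, n + k + 1 = N := ⟨N - n - 1, by omega⟩
  induction k generalizing n with
  | zero =>
    have hrow : (bidiagonal N q' e')ᵀ ⟨n, hn⟩ ∈
        Submodule.span R (Set.range (bidiagonal N q' e')ᵀ) := Submodule.subset_span ⟨_, rfl⟩
    rw [bidiagonal_transpose_row, stdVec_eq_zero (n := n + 1) (by omega), smul_zero,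
      add_zero] at hrow
    rw [← h.q_eq n hn, mul_comm, mul_smul]
    exact Submodule.smul_mem _ _ hrow
  | succ k ih =>
    have hrow : (bidiagonal N q' e')ᵀ ⟨n, hn⟩ ∈
        Submodule.span R (Set.range (bidiagonal N q' e')ᵀ) := Submodule.subset_span ⟨_, rfl⟩
    rw [bidiagonal_transpose_row] at hrow
    convert sub_mem (Submodule.smul_mem _ (α (n + 1)) hrow)
      (Submodule.smul_mem _ (b n) (ih (n + 1) (by omega) (by omega))) using 1
    have h1 := h.q_eq n (by omega)
    have h2 := h.e'_eq n (by omega)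
    simp only [smul_add, smul_smul, h2, ← h1]
    rw [show α (n + 1) * (b n * q (n + 1)) = b n * (α (n + 1) * q (n + 1)) by ring,
      add_sub_cancel_right, mul_comm]

open Classical in
/-- The determinantal ideals are constants of motion. -/
theorem TodaStep.detIdeal_eq (h : TodaStep N q e q' e' α b) (k : ℕ) :
    detIdeal k (bidiagonal N q' e') = detIdeal k (bidiagonal N q e) := by
  rw [← detIdeal_transpose k (bidiagonal N q' e')]
  refine le_antisymm (detIdeal_le_of_local k fun m hm => ?_)
    (detIdeal_le_of_local k fun m hm => ?_)
  all_goals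
    have hp := hm.isPrime
    have h1m : (1 : R) ∉ m := (Ideal.ne_top_iff_one m).mp hm.ne_top
    have hα : ∀ n, n < N → b n ∈ m → α (n + 1) ∉ m := fun n hn hb ha => by
      obtain ⟨x, y, hxy⟩ := h.coprime n hn
      exact h1m (hxy ▸ add_mem (m.mul_mem_left x ha) (m.mul_mem_left y hb))
    -- Ratio of neighbouring column scalings. When `b n ∉ m`, the coefficients `b n * q' n, q (n +
    -- 1)` of a row of the old matrix must become proportional to `q' n, b n * q (n + 1)`, which
    -- costs `b n ^ 2`.
    let τ : ℕ → R := fun n => if b n ∈ m then 1 else b n ^ 2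
    have hτ : ∀ n, τ n ∉ m := fun n => by
      simp only [τ]
      split_ifs with hb
      · exact h1m
      · exact fun h2 => hb (hp.mem_of_pow_mem 2 h2)
  · let c : ℕ → R := fun n => ∏ j ∈ Finset.Ico n N, τ j
    let E : ℕ → R := fun n => if b n ∈ m then α (n + 1) else 1
    refine ⟨fun i => E i, fun i => c i, fun i => ?_, fun i hi => ?_, fun i => ?_⟩
    · simp only [E]
      split_ifs with hb
      · exact hα i i.2 hb
      · exact h1m
    · obtain ⟨j, -, hj⟩ := hp.prod_mem_iff.mp hi
      exact hτ j hj
    · rw [scaled_transpose_row]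
      obtain ⟨n, hn⟩ := i
      simp only
      have hc : c n = τ n * c (n + 1) := Finset.prod_eq_prod_Ico_succ_bot hn _
      by_cases hb : b n ∈ m
      · have hE : E n = α (n + 1) := if_pos hb
        rw [hE, mul_comm (α (n + 1)), h.q_eq n hn, mul_comm _ (c n), mul_smul]
        refine add_mem (Submodule.smul_mem _ _ (h.smul_stdVec_mem_rows n)) ?_
        rcases Nat.lt_or_ge (n + 1) N with hn1 | hn1
        · rw [h.e'_eq n hn1, show α (n + 1) * (b n * q (n + 1)) * c (n + 1) =
            (b n * c (n + 1)) * (α (n + 1) * q (n + 1)) by ring, mul_smul]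
          exact Submodule.smul_mem _ _ (h.smul_stdVec_mem_rows (n + 1))
        · rw [stdVec_eq_zero hn1, smul_zero]
          exact zero_mem _
      -- The last index never falls in this case, because `b (N - 1) = 0`.
      · have hn1 : n + 1 < N := by
          by_contra hcon
          exact hb (by rw [h.b_last n (by omega)]; exact zero_mem m)
        have hE : E n = 1 := if_neg hb
        have hτn : τ n = b n ^ 2 := if_neg hb
        have hrow : bidiagonal N q e ⟨n + 1, hn1⟩ ∈
          Submodule.span R (Set.range (bidiagonal N q e)) := Submodule.subset_span ⟨_, rfl⟩
        rw [bidiagonal_row_succ q e ⟨n + 1, hn1⟩ n rfl] at hrow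
        convert Submodule.smul_mem _ (c (n + 1) * b n) hrow using 1
        rw [hE, hc, hτn, h.e'_eq n hn1, h.e_eq n hn, smul_add, smul_smul, smul_smul]
        congr 2 <;> ring
  · let c : ℕ → R := fun n => ∏ j ∈ Finset.range n, τ j
    -- Shifted by one, since row `n + 1` of the old matrix is matched with column `n` of the new
    -- one; row `0` needs no factor because `α 0 = 1`.
    let E : ℕ → R := fun n => Nat.casesOn n 1 fun n => if b n ∈ m then α (n + 1) else 1
    refine ⟨fun i => E i, fun i => c i, fun i => ?_, fun i hi => ?_, fun i => ?_⟩
    · obtain ⟨n, hn⟩ := i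
      cases n with
      | zero => exact h1m
      | succ n =>
        simp only [E]
        split_ifs with hb
        · exact hα n (by omega) hb
        · exact h1m
    · obtain ⟨j, -, hj⟩ := hp.prod_mem_iff.mp hi
      exact hτ j hj
    · obtain ⟨n, hn⟩ := i
      cases n with
      | zero =>
        rw [scaled_row_zero E c q e ⟨0, hn⟩ rfl]
        have := h.smul_stdVec_mem_columns 0
        rw [h.α_zero, one_mul] at this
        rw [mul_right_comm, mul_smul]
        exact Submodule.smul_mem _ _ this
      | succ n =>
        rw [scaled_row_succ E c q e ⟨n + 1, hn⟩ n rfl]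
        have hc : c (n + 1) = c n * τ n := Finset.prod_range_succ _ _
        by_cases hb : b n ∈ m
        · have hE : E (n + 1) = α (n + 1) := if_pos hb
          rw [hE, mul_right_comm (α (n + 1)) (q (n + 1)), mul_right_comm, mul_comm (_ * _) (e n),
            h.e_eq n (by omega), mul_comm (α (n + 1)) (c (n + 1)),
            mul_assoc (c (n + 1)), mul_smul (c (n + 1)),
            show q' n * b n * (α (n + 1) * c n) = b n * c n * (q' n * α (n + 1)) by ring,
            h.q_eq n (by omega), mul_smul (b n * c n)]
          exact add_mem (Submodule.smul_mem _ _ (h.smul_stdVec_mem_columns n))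
            (Submodule.smul_mem _ _ (h.smul_stdVec_mem_columns (n + 1)))
        · have hE : E (n + 1) = 1 := if_neg hb
          have hτn : τ n = b n ^ 2 := if_neg hb
          have hrow : (bidiagonal N q' e')ᵀ ⟨n, by omega⟩ ∈
            Submodule.span R (Set.range (bidiagonal N q' e')ᵀ) := Submodule.subset_span ⟨_, rfl⟩
          rw [bidiagonal_transpose_row] at hrow
          convert Submodule.smul_mem _ (c n * b n) hrow using 1
          simp only
          rw [hE, hc, hτn, h.e'_eq n hn, h.e_eq n (by omega), smul_add, smul_smul, smul_smul]
          congr 2 <;> ring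

end Step

end GcdToda

namespace GcdToda

open Matrix

/-! ### Determinant and diagonalization of bidiagonal matrices. -/

section Bidiagonal

variable {R : Type*} [CommRing R] {N : ℕ}

theorem det_bidiagonal (q e : ℕ → R) : (bidiagonal N q e).det = ∏ i : Fin N, q i := by
  rw [det_of_isLowerTriangular]
  · simp [bidiagonal]
  · intro i j hij
    have hij : i < j := hij
    rw [Fin.lt_def] at hij
    simp only [bidiagonal, of_apply]
    rw [if_neg (by omega), if_neg (by omega)]

theorem equivalent_diagonal_of_dvd {q e : ℕ → R} (h : ∀ n, n < N → q n ∣ e n) :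
    Equivalent (bidiagonal N q e) (diagonal fun n : Fin N => q n) := by
  choose! x hx using h
  let L : Matrix (Fin N) (Fin N) R := bidiagonal N (fun _ => 1) x
  have hL : IsUnit L.det := by simp [L, det_bidiagonal]
  refine Equivalent.symm (.of_mul (P := L) (P' := L⁻¹) (mul_nonsing_inv L hL) (mul_one 1) ?_)
  ext i j
  simp only [L, mul_one, mul_diagonal, bidiagonal, of_apply, ite_mul, one_mul, zero_mul]
  rw [hx j j.2, mul_comm]

end Bidiagonal

/-! ### Existence and nonvanishing of solutions. -/

section Solutions

variable {R : Type*} [CommRing R] [IsDomain R] [IsPrincipalIdealRing R] {N : ℕ}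

theorem exists_step (N : ℕ) (p : (ℕ → R) × (ℕ → R)) : ∃ p' : (ℕ → R) × (ℕ → R),
    (∀ n, ∃ c : R, IsQuotient c (∏ j ∈ Finset.range (n + 1), p.1 j)
        (∏ j ∈ Finset.range n, p'.1 j) ∧ IsGcdOf (p'.1 n) (p.2 n) c) ∧
      (∀ n, n + 1 < N → IsQuotient (p'.2 n) (p.2 n * p.1 (n + 1)) (p'.1 n)) ∧
      ∀ n, n + 1 = N → p'.2 n = 0 := by
  obtain ⟨q, e⟩ := p
  choose g u v a b hx hy hg hab using exists_bezout (R := R)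
  -- The leftover cofactor is carried from one gcd to the next; `hprod` then identifies the quotient
  -- of products with `α n * q n`.
  let α : ℕ → R := fun n => Nat.rec 1 (fun n α => a (α * q n) (e n)) n
  let q' : ℕ → R := fun n => g (α n * q n) (e n)
  have hα : ∀ n, α n * q n = q' n * α (n + 1) := fun n => hx _ _
  have hprod : ∀ n, ∏ j ∈ Finset.range n, q j = (∏ j ∈ Finset.range n, q' j) * α n := by
    intro n
    induction n with
    | zero => simp [α]
    | succ n ih =>
      rw [Finset.prod_range_succ, Finset.prod_range_succ, ih, mul_assoc, hα, mul_assoc]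
  refine ⟨⟨q', fun n => if n + 1 < N then b (α n * q n) (e n) * q (n + 1) else 0⟩,
    fun n => ⟨α n * q n, ?_, ?_, ?_, fun c h1 h2 => ?_⟩, fun n hn => ?_, fun n hn => ?_⟩
  · simp only [IsQuotient]
    rw [Finset.prod_range_succ, hprod, mul_assoc]
  · exact ⟨_, hy _ _⟩
  · exact ⟨_, hx _ _⟩
  · exact (dvd_add (h2.mul_left _) (h1.mul_left _)).trans (hg (α n * q n) (e n)).dvd
  · simp only [IsQuotient, if_pos hn]
    rw [← mul_assoc]
    exact congrArg (· * q (n + 1)) (hy (α n * q n) (e n))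
  · simp only
    rw [if_neg (by omega)]

theorem exists_isSolution (q₀ e₀ : ℕ → R) (h : ∀ n, n + 1 = N → e₀ n = 0) :
    ∃ q e : ℕ → ℕ → R, IsSolution N q e ∧ q 0 = q₀ ∧ e 0 = e₀ := by
  choose F hq he hb using exists_step (R := R) N
  let s : ℕ → (ℕ → R) × (ℕ → R) := fun t => Nat.rec (q₀, e₀) (fun _ p => F p) t
  refine ⟨fun t => (s t).1, fun t => (s t).2,
    ⟨fun t n _ => hq (s t) n, fun t n hn => he (s t) n hn, fun t n hn => ?_⟩, rfl, rfl⟩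
  cases t with
  | zero => exact h n hn
  | succ t => exact hb (s t) n hn

theorem IsSolution.exists_todaStep {q e : ℕ → ℕ → R} (h : IsSolution N q e) (t : ℕ)
    (hq : ∀ n, n < N → q t n ≠ 0) (he : ∀ n, n + 1 < N → e t n ≠ 0) :
    (∃ α b : ℕ → R, TodaStep N (q t) (e t) (q (t + 1)) (e (t + 1)) α b) ∧
      (∀ n, n < N → q (t + 1) n ≠ 0) ∧ ∀ n, n + 1 < N → e (t + 1) n ≠ 0 := by
  choose! c hc hgcd using h.q_step t
  have hprod : ∀ n, n < N → ∏ j ∈ Finset.range (n + 1), q t j ≠ 0 := fun n hn =>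
    Finset.prod_ne_zero_iff.mpr fun j hj => hq j (by have := Finset.mem_range.mp hj; omega)
  have hc0 : ∀ n, n < N → c n ≠ 0 := fun n hn h0 => hprod n hn (by
    have := hc n hn
    rwa [IsQuotient, h0, mul_zero] at this)
  choose! a ha using fun n hn => (hgcd n hn).2.1
  choose! b hb using fun n hn => (hgcd n hn).1
  have hq' : ∀ n, n < N → q (t + 1) n ≠ 0 := fun n hn h0 => hc0 n hn (by
    rw [ha n hn, h0, zero_mul])
  have hstep : TodaStep N (q t) (e t) (q (t + 1)) (e (t + 1)) (fun n => Nat.casesOn n 1 a) b := by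
    refine ⟨rfl, fun n hn => ?_, hb, fun n hn => ?_, fun n hn => ?_, fun n hn => ?_⟩
    · cases n with
      | zero =>
        have := hc 0 hn
        simp only [IsQuotient, zero_add, Finset.prod_range_one, Finset.range_zero,
          Finset.prod_empty, one_mul] at this
        simp [this, ha 0 hn]
      | succ n =>
        have h1 := hc (n + 1) hn
        have h2 := hc n (by omega)
        simp only [IsQuotient] at h1 h2
        rw [Finset.prod_range_succ, h2, Finset.prod_range_succ, ha n (by omega), ha _ hn] at h1
        have h3 : ∏ j ∈ Finset.range n, q (t + 1) j ≠ 0 := fun h0 => hprod n (by omega) (by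
          rw [h2, h0, zero_mul])
        refine mul_left_cancel₀ (mul_ne_zero h3 (hq' n (by omega))) ?_
        simp only
        linear_combination -h1
    · refine mul_left_cancel₀ (hq' n (by omega)) ?_
      rw [← h.e_step t n hn, hb n (by omega), mul_assoc]
    -- A common divisor `d` of the cofactors would make `q (t + 1) n * d` a common divisor, hence a
    -- divisor of the gcd `q (t + 1) n`.
    · refine IsRelPrime.isCoprime fun d hd1 hd2 => ?_
      have := (hgcd n hn).2.2 (q (t + 1) n * d)
        (by rw [hb n hn]; exact mul_dvd_mul_left _ hd2)
        (by rw [ha n hn]; exact mul_dvd_mul_left _ hd1)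
      rw [← mul_one (q (t + 1) n), mul_assoc, one_mul, mul_dvd_mul_iff_left (hq' n hn)] at this
      exact isUnit_of_dvd_one this
    · have := hb n (by omega)
      rw [h.e_boundary t n hn] at this
      exact (mul_eq_zero.mp this.symm).resolve_left (hq' n (by omega))
  refine ⟨⟨_, b, hstep⟩, hq', fun n hn h0 => ?_⟩
  have := h.e_step t n hn
  rw [IsQuotient, h0, mul_zero] at this
  exact mul_ne_zero (he n hn) (hq (n + 1) hn) this

theorem IsSolution.ne_zero {q e : ℕ → ℕ → R} (h : IsSolution N q e)
    (hq : ∀ n, n < N → q 0 n ≠ 0) (he : ∀ n, n + 1 < N → e 0 n ≠ 0) (t : ℕ) :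
    (∀ n, n < N → q t n ≠ 0) ∧ ∀ n, n + 1 < N → e t n ≠ 0 := by
  induction t with
  | zero => exact ⟨hq, he⟩
  | succ t ih => exact (h.exists_todaStep t ih.1 ih.2).2

/-- After the gcd is cancelled, every power of the cofactor `a` of `x` divides `c ≠ 0`, so `a` is a
unit. -/
theorem dvd_of_forall_pow_dvd {x y c : R} (hx : x ≠ 0) (hc : c ≠ 0)
    (h : ∀ m : ℕ, x ^ m ∣ c * y ^ m) : x ∣ y := by
  obtain ⟨g, u, v, a, b, rfl, rfl, -, hab⟩ := exists_bezout x y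
  have hg : g ≠ 0 := left_ne_zero_of_mul hx
  have hcop : IsCoprime a b := ⟨u, v, hab⟩
  have ha : ∀ m : ℕ, a ^ m ∣ c := fun m => by
    have := h m
    rw [mul_pow, mul_pow, mul_left_comm, mul_dvd_mul_iff_left (pow_ne_zero m hg)] at this
    exact (hcop.pow (m := m) (n := m)).dvd_of_dvd_mul_right this
  have hu : IsUnit a := by
    by_contra hnu
    obtain ⟨n, hn⟩ := FiniteMultiplicity.of_not_isUnit hnu hc
    exact hn (ha _)
  exact mul_dvd_mul_left g hu.dvd

/-! ### Stabilization and the divisibility chain. -/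

section Limit

variable {q e α b : ℕ → ℕ → R}

theorem exists_forall_isUnit
    (h : ∀ t, TodaStep N (q t) (e t) (q (t + 1)) (e (t + 1)) (α t) (b t))
    (hq : ∀ t n, n < N → q t n ≠ 0) (n : ℕ) (hn : n ≤ N) :
    ∃ T, ∀ t, T ≤ t → ∀ j, j ≤ n → IsUnit (α t j) := by
  induction n with
  | zero =>
    refine ⟨0, fun t _ j hj => ?_⟩
    rw [Nat.le_zero.mp hj, (h t).α_zero]
    exact isUnit_one
  | succ n ih =>
    obtain ⟨T, hT⟩ := ih (by omega)
    have hdvd : ∀ t, T ≤ t → q (t + 1) n ∣ q t n := fun t ht => by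
      have := (hT t ht n le_rfl).dvd_mul_left.mp (Dvd.intro _ ((h t).q_eq n (by omega)))
      exact this
    -- Descending divisibility is an ascending chain of principal ideals, hence stationary.
    let f : ℕ →o Ideal R := ⟨fun k => Ideal.span {q (T + k) n}, monotone_nat_of_le_succ fun k =>
      Ideal.span_singleton_le_span_singleton.mpr (hdvd (T + k) (by omega))⟩
    obtain ⟨K, hK⟩ := monotone_stabilizes_iff_noetherian.mpr (inferInstance : IsNoetherian R R) f
    refine ⟨T + K, fun t ht j hj => ?_⟩
    rcases Nat.lt_or_ge n j with hlt | hle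
    swap
    · exact hT t (by omega) j hle
    obtain rfl : j = n + 1 := by omega
    obtain ⟨k, rfl⟩ : ∃ k, t = T + k := ⟨t - T, by omega⟩
    have heq : f (k + 1) = f k := (hK (k + 1) (by omega)).symm.trans (hK k (by omega))
    obtain ⟨w, hw⟩ : q (T + k) n ∣ q (T + k + 1) n :=
      Ideal.span_singleton_le_span_singleton.mp heq.le
    refine isUnit_of_dvd_unit ⟨w, ?_⟩ (hT (T + k) (by omega) n le_rfl)
    have := (h (T + k)).q_eq n (by omega)
    rw [hw] at this
    refine mul_left_cancel₀ (hq (T + k) n (by omega)) ?_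
    linear_combination -this

theorem exists_forall_associated_succ
    (h : ∀ t, TodaStep N (q t) (e t) (q (t + 1)) (e (t + 1)) (α t) (b t))
    (hq : ∀ t n, n < N → q t n ≠ 0) :
    ∃ T, ∀ t, T ≤ t → ∀ n, n < N → Associated (q (t + 1) n) (q t n) := by
  obtain ⟨T, hT⟩ := exists_forall_isUnit h hq N le_rfl
  refine ⟨T, fun t ht n hn => ?_⟩
  have h1 := (h t).q_eq n hn
  have h2 := associated_mul_unit_right (q (t + 1) n) _ (hT t ht (n + 1) hn)
  rw [h1] at h2
  exact h2.trans (associated_unit_mul_left _ _ (hT t ht n hn.le))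

/-- Once the `q t n` are stationary up to units, they form a divisibility chain. -/
theorem dvd_succ_of_associated
    (h : ∀ t, TodaStep N (q t) (e t) (q (t + 1)) (e (t + 1)) (α t) (b t))
    (hq : ∀ t n, n < N → q t n ≠ 0) (he : ∀ t n, n + 1 < N → e t n ≠ 0) {T : ℕ}
    (hT : ∀ t, T ≤ t → ∀ n, n < N → Associated (q (t + 1) n) (q t n)) {n : ℕ} (hn : n + 1 < N) :
    q T n ∣ q T (n + 1) := by
  have hqT : ∀ k j, j < N → Associated (q (T + k) j) (q T j) := fun k j hj => by
    induction k with
    | zero => exact .refl _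
    | succ k ih => exact (hT (T + k) (by omega) j hj).trans ih
  -- The recursion `e' n * q' n = e n * q (n + 1)` iterated `m` times, with the `q` frozen at time
  -- `T` up to units.
  have key : ∀ m, Associated (e (T + m) n * q T n ^ m) (e T n * q T (n + 1) ^ m) := fun m => by
    induction m with
    | zero => simp
    | succ m ih =>
      have h1 : e (T + m + 1) n * q (T + m + 1) n = e (T + m) n * q (T + m) (n + 1) := by
        rw [(h (T + m)).e'_eq n hn, (h (T + m)).e_eq n (by omega)]
        ring
      have h2 : Associated (e (T + m + 1) n * q T n) (e (T + m) n * q T (n + 1)) :=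
        ((Associated.refl _).mul_mul (hqT (m + 1) n (by omega)).symm).trans
          (h1 ▸ (Associated.refl _).mul_mul (hqT m (n + 1) hn))
      have h3 := h2.mul_mul (Associated.refl (q T n ^ m))
      have h4 := ih.mul_mul (Associated.refl (q T (n + 1)))
      have e1 : e (T + (m + 1)) n * q T n ^ (m + 1) = e (T + m + 1) n * q T n * q T n ^ m := by
        rw [← add_assoc]
        ring
      have e2 : e (T + m) n * q T (n + 1) * q T n ^ m =
        e (T + m) n * q T n ^ m * q T (n + 1) := by ring
      rw [e1, pow_succ, ← mul_assoc]
      rw [e2] at h3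
      exact h3.trans h4
  exact dvd_of_forall_pow_dvd (hq T n (by omega)) (he T n hn) fun m =>
    (Dvd.intro_left _ rfl).trans (key m).dvd

end Limit

end Solutions

end GcdToda

theorem theorem3p1 {R : Type*} [CommRing R] [IsDomain R] [IsPrincipalIdealRing R] (N : ℕ)
    (X₀ : Matrix (Fin N) (Fin N) R) (hX₀ : GcdToda.IsLowerBidiagonal X₀)
    (hdiag : ∀ i : Fin N, X₀ i i ≠ 0)
    (hsub : ∀ i j : Fin N, (i : ℕ) = (j : ℕ) + 1 → X₀ i j ≠ 0) :
    (∃ q e : ℕ → ℕ → R,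
      GcdToda.IsSolution N q e ∧ GcdToda.bidiagonal N (q 0) (e 0) = X₀) ∧
    ∀ q e : ℕ → ℕ → R, GcdToda.IsSolution N q e → GcdToda.bidiagonal N (q 0) (e 0) = X₀ →
      (∀ t n : ℕ, (n < N → q t n ≠ 0) ∧ (n + 1 < N → e t n ≠ 0)) ∧
      (∀ (t : ℕ) (s : Fin N → R),
        GcdToda.IsInvariantFactors (GcdToda.bidiagonal N (q t) (e t)) s ↔
          GcdToda.IsInvariantFactors X₀ s) ∧
      ∃ T : ℕ, ∀ t : ℕ, T ≤ t →
        GcdToda.IsInvariantFactors X₀ (fun n : Fin N => q t n) ∧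
        ∀ s : Fin N → R, GcdToda.IsInvariantFactors X₀ s →
          ∀ n : Fin N, Associated (q t n) (s n) := by
  open GcdToda in
  refine ⟨?_, fun q e hsol hinit => ?_⟩
  · obtain ⟨q, e, hsol, hq, he⟩ := exists_isSolution (N := N)
      (fun n => if h : n < N then X₀ ⟨n, h⟩ ⟨n, h⟩ else 0)
      (fun n => if h : n + 1 < N then X₀ ⟨n + 1, h⟩ ⟨n, by omega⟩ else 0)
      (fun n hn => dif_neg (by omega))
    refine ⟨q, e, hsol, ?_⟩
    rw [hq, he]
    ext i j
    simp only [bidiagonal, Matrix.of_apply]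
    split_ifs with h1 <;> first | omega | skip
    · rw [Fin.ext h1]
    · exact congrArg (fun k => X₀ k j) (Fin.ext (Eq.symm ‹(i : ℕ) = j + 1›))
    · exact (hX₀ i j h1 ‹¬(i : ℕ) = j + 1›).symm
  have hq0 : ∀ n, n < N → q 0 n ≠ 0 := fun n hn => by
    have := hdiag ⟨n, hn⟩
    rwa [← hinit, bidiagonal, Matrix.of_apply, if_pos rfl] at this
  have he0 : ∀ n, n + 1 < N → e 0 n ≠ 0 := fun n hn => by
    have := hsub ⟨n + 1, hn⟩ ⟨n, by omega⟩ rfl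
    rwa [← hinit, bidiagonal, Matrix.of_apply, if_neg (by simp), if_pos rfl] at this
  have hne := hsol.ne_zero hq0 he0
  choose α b hstep using fun t => (hsol.exists_todaStep t (hne t).1 (hne t).2).1
  have hdet : X₀.det ≠ 0 := by
    rw [← hinit, det_bidiagonal]
    exact Finset.prod_ne_zero_iff.mpr fun i _ => hq0 i i.2
  have hideal : ∀ t k, detIdeal k X₀ = detIdeal k (bidiagonal N (q t) (e t)) := fun t k => by
    induction t with
    | zero => rw [hinit]
    | succ t ih => rw [ih, (hstep t).detIdeal_eq k]
  have hequiv : ∀ t, Equivalent X₀ (bidiagonal N (q t) (e t)) := fun t =>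
    equivalent_of_detIdeal_eq hdet (hideal t)
  refine ⟨fun t n => ⟨(hne t).1 n, (hne t).2 n⟩,
    fun t s => ((hequiv t).isInvariantFactors_iff s).symm, ?_⟩
  obtain ⟨T, hT⟩ := exists_forall_associated_succ hstep fun t => (hne t).1
  refine ⟨T, fun t ht => ?_⟩
  have hfac : IsInvariantFactors X₀ (fun n : Fin N => q t n) := by
    refine ⟨(hequiv t).trans (equivalent_diagonal_of_dvd fun n hn => ?_), fun i j hij => ?_⟩
    · exact (hT t ht n hn).symm.dvd.trans (Dvd.intro _ ((hstep t).e_eq n hn).symm)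
    · have key : ∀ k, ∀ i, i + k < N → q t i ∣ q t (i + k) := fun k i hk => by
        induction k with
        | zero => exact dvd_rfl
        | succ k ih =>
          exact (ih (by omega)).trans (dvd_succ_of_associated hstep (fun t => (hne t).1)
            (fun t => (hne t).2) (fun s hs => hT s (ht.trans hs)) hk)
      have := key (j - i) i (by omega)
      rwa [Nat.add_sub_cancel' hij] at this
  exact ⟨hfac, fun s hs n => hfac.associated hs hdet (fun k => rfl) n⟩
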